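/- All graphs are finite and simple. Let $P_k$ denote the path on $k$ vertices and let $P_2\cup P_4$ be the vertex-disjoint union of $P_2$ and $P_4$. A bull is a triangle with two disjoint pendant edges, and a diamond consists of two triangles sharing exactly one edge. A graph is $(P_2\cup P_4,\text{bull},\text{diamond})$-free if none of its induced subgraphs is isomorphic to $P_2\cup P_4$, to the bull or to the diamond. Write $\chi(G)$ for the chromatic number and $\omega(G)$ for the clique number of $G$. Every $(P_2\cup P_4,\text{bull},\text{diamond})$-free graph $G$ satisfies $$\chi(G)\le \max\{4,\omega(G)\}.$$ This bound is optimal in the following sense: for $k=2$ and for every integer $k\ge 4$ there is a $(P_2\cup P_4,\text{bull},\text{diamond})$-free graph $G$ with $\omega(G)=k$ and $\chi(G)=\max\{4,k\}$. In particular, every value of the bound is attained, and the constant $4$ cannot be replaced by a smaller one. -/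

import Mathlib

namespace SimpleGraph

/-- The bull: the triangle on `0, 1, 2` with two disjoint pendant edges `0 - 3` and `1 - 4`. -/
def bull : SimpleGraph (Fin 5) :=
  fromEdgeSet {s(0, 1), s(0, 2), s(1, 2), s(0, 3), s(1, 4)}

/-- The diamond: the two triangles `0, 1, 2` and `1, 2, 3`, sharing exactly the edge `1 - 2`. -/
def diamond : SimpleGraph (Fin 4) :=
  fromEdgeSet {s(0, 1), s(0, 2), s(1, 2), s(1, 3), s(2, 3)}

/-- The graph `P₂ ∪ P₄`: the vertex-disjoint union of a path on 2 vertices and a path on 4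
vertices. -/
def P2P4 : SimpleGraph (Fin 2 ⊕ Fin 4) :=
  pathGraph 2 ⊕g pathGraph 4

/-- `G` is `H`-free: no induced subgraph of `G` is isomorphic to `H`. -/
def IsIndFree {V W : Type*} (G : SimpleGraph V) (H : SimpleGraph W) : Prop :=
  ¬ H.IsIndContained G

/-- `G` is `(P₂ ∪ P₄, bull, diamond)`-free. -/
def IsP2P4BullDiamondFree {V : Type*} (G : SimpleGraph V) : Prop :=
  G.IsIndFree P2P4 ∧ G.IsIndFree bull ∧ G.IsIndFree diamond

end SimpleGraph

namespace SimpleGraph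

/-! Put n = max(4, ω) and induct on the vertex set S. A vertex with fewer than n neighbours in S can
be coloured last. If S is triangle-free, fix an edge uv: the neighbourhoods of u and v are
independent, and the vertices missing both induce a graph without triangles or induced P₄, hence
bipartite; four colours suffice (`colorableOn_four_of_triangleFree`). Otherwise all degrees are at
least n and a maximum clique K has at least three vertices. Then `exists_outer_neighbor` matches K
with a second clique L. Applied to L as well, it shows that K ∪ L is a union of components of S, two
copies of Kₙ joined by a perfect matching; a cyclic shift of colours handles it and induction the
rest.

For optimality, complete graphs serve k ≥ 4 and the Grötzsch graph serves k = 2. -/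

/-- A graph is `H`-free as soon as no map from `H` preserves and reflects adjacency. -/
theorem isIndFree_of_forall {V W : Type*} {G : SimpleGraph V} {H : SimpleGraph W}
    (h : ∀ f : W → V, ¬ ∀ i j, G.Adj (f i) (f j) ↔ H.Adj i j) : G.IsIndFree H :=
  fun ⟨f⟩ ↦ h f fun _ _ ↦ f.map_adj_iff

/-! ### Forbidden induced subgraphs as rules forcing an edge -/

section Free

variable {V : Type*} {G : SimpleGraph V}

/-- `a ≠ d` must be assumed: the two ends of a diamond have the same neighbours, so adjacency alone
cannot separate them. -/
theorem IsIndFree.adj_of_diamond (h : G.IsIndFree diamond) {a b c d : V} (hab : G.Adj a b)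
    (hac : G.Adj a c) (hbc : G.Adj b c) (hbd : G.Adj b d) (hcd : G.Adj c d) (hne : a ≠ d) :
    G.Adj a d := by
  by_contra had
  have key : ∀ i j, G.Adj (![a, b, c, d] i) (![a, b, c, d] j) ↔ diamond.Adj i j := by
    have hda : ¬ G.Adj d a := fun h ↦ had h.symm
    intro i j
    fin_cases i <;> fin_cases j <;>
      simp [diamond, hab, hac, hbc, hbd, hcd, hab.symm, hac.symm, hbc.symm, hbd.symm, hcd.symm,
        had, hda]
  refine h ⟨⟨⟨![a, b, c, d], fun i j hij ↦ ?_⟩, key _ _⟩⟩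
  have := hab.ne
  have := hac.ne
  have := hbc.ne
  have := hbd.ne
  have := hcd.ne
  fin_cases i <;> fin_cases j <;> simp_all

theorem IsIndFree.adj_of_bull (h : G.IsIndFree bull) {a b c x y : V} (hab : G.Adj a b)
    (hac : G.Adj a c) (hbc : G.Adj b c) (hax : G.Adj a x) (hby : G.Adj b y) (hay : ¬ G.Adj a y)
    (hbx : ¬ G.Adj b x) (hcx : ¬ G.Adj c x) (hcy : ¬ G.Adj c y) : G.Adj x y := by
  by_contra hxy
  have ne_ax := hax.ne
  have ne_by := hby.ne
  have ne_ay : a ≠ y := by rintro rfl; exact hxy hax.symm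
  have ne_bx : b ≠ x := by rintro rfl; exact hxy hby
  have ne_cx : c ≠ x := by rintro rfl; exact hbx hbc
  have ne_cy : c ≠ y := by rintro rfl; exact hay hac
  have ne_xy : x ≠ y := by rintro rfl; exact hay hax
  have := hab.ne
  have := hac.ne
  have := hbc.ne
  have key : ∀ i j, G.Adj (![a, b, c, x, y] i) (![a, b, c, x, y] j) ↔ bull.Adj i j := by
    have hya := mt G.adj_symm hay
    have hxb := mt G.adj_symm hbx
    have hxc := mt G.adj_symm hcx
    have hyc := mt G.adj_symm hcy
    have hyx := mt G.adj_symm hxy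
    intro i j
    fin_cases i <;> fin_cases j <;>
      simp [bull, hab, hac, hbc, hax, hby, hab.symm, hac.symm, hbc.symm, hax.symm, hby.symm,
        hay, hbx, hcx, hcy, hxy, hya, hxb, hxc, hyc, hyx]
  refine h ⟨⟨⟨![a, b, c, x, y], fun i j hij ↦ ?_⟩, key _ _⟩⟩
  fin_cases i <;> fin_cases j <;> simp_all

theorem IsIndFree.adj_of_P2P4 (h : G.IsIndFree P2P4) {u v a b c d : V} (huv : G.Adj u v)
    (hab : G.Adj a b) (hbc : G.Adj b c) (hcd : G.Adj c d) (hac : ¬ G.Adj a c) (hbd : ¬ G.Adj b d)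
    (hu : ∀ x ∈ [a, b, c, d], ¬ G.Adj u x) (hv : ∀ x ∈ [a, b, c, d], ¬ G.Adj v x) :
    G.Adj a d := by
  by_contra had
  simp only [List.mem_cons, List.not_mem_nil, or_false, forall_eq_or_imp, forall_eq] at hu hv
  obtain ⟨hua, hub, huc, hud⟩ := hu
  obtain ⟨hva, hvb, hvc, hvd⟩ := hv
  have key : ∀ i j, G.Adj (Sum.elim ![u, v] ![a, b, c, d] i) (Sum.elim ![u, v] ![a, b, c, d] j) ↔
      P2P4.Adj i j := by
    rintro (i | i) (j | j) <;> fin_cases i <;> fin_cases j <;>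
      simp_all [P2P4, pathGraph_adj, G.adj_comm]
  refine h ⟨⟨⟨Sum.elim ![u, v] ![a, b, c, d], fun i j hij ↦ ?_⟩, key _ _⟩⟩
  -- Distinct vertices of P₂ ∪ P₄ have distinct neighbourhoods, so a map preserving and reflecting
  -- adjacency is injective.
  have twin : ∀ k, P2P4.Adj i k ↔ P2P4.Adj j k := fun k ↦ by rw [← key, ← key, hij]
  have t₁ := fun k ↦ twin (.inl k)
  have t₂ := fun k ↦ twin (.inr k)
  revert t₁ t₂
  clear twin hij
  rcases i with i | i <;> rcases j with j | j <;> fin_cases i <;> fin_cases j <;>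
    simp [P2P4, pathGraph_adj, Fin.forall_fin_succ]

end Free

/-- Triangle-free graphs without induced `P₄` are bipartite. -/
theorem colorable_two_of_forall {V : Type*} {G : SimpleGraph V}
    (htri : ∀ a b c, G.Adj a b → G.Adj b c → ¬ G.Adj a c)
    (hP4 : ∀ a b c d, G.Adj a b → G.Adj b c → G.Adj c d → G.Adj a d) : G.Colorable 2 := by
  classical
  let r : V → V := fun v ↦ (G.connectedComponentMk v).out
  have hr : ∀ v, G.Reachable (r v) v := fun v ↦
    ConnectedComponent.exact (Quot.out_eq (G.connectedComponentMk v))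
  -- Three consecutive edges shortcut to one, so every vertex is within distance two of its root;
  -- adjacency to the root is then a 2-colouring.
  have near : ∀ u v, G.Reachable u v → v = u ∨ G.Adj u v ∨ ∃ a, G.Adj u a ∧ G.Adj a v := by
    rintro u v ⟨p⟩
    induction p using Walk.concatRec with
    | Hnil => exact .inl rfl
    | Hconcat p h ih =>
      rcases ih with rfl | h' | ⟨a, h₁, h₂⟩
      · exact .inr (.inl h)
      · exact .inr (.inr ⟨_, h', h⟩)
      · exact .inr (.inl (hP4 _ _ _ _ h₁ h₂ h))
  have hcol : ∀ {x y}, G.Adj x y → decide (G.Adj (r x) x) ≠ decide (G.Adj (r y) y) := by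
    intro x y hxy heq
    have hrxy : r x = r y := by
      simp only [r, ConnectedComponent.sound hxy.reachable]
    by_cases hx : G.Adj (r x) x
    · have hy : G.Adj (r y) y := by simpa [hx] using heq
      exact htri _ _ _ hx hxy (hrxy ▸ hy)
    · have hy : ¬ G.Adj (r x) y := by simpa [hx, hrxy.symm] using heq
      rcases near _ _ (hr x) with h | h | ⟨a, h₁, h₂⟩
      · exact hy (h ▸ hxy)
      · exact hx h
      · exact hy (hP4 _ _ _ _ h₁ h₂ hxy)
  simpa using (Coloring.mk _ hcol).colorable

/-! ### The upper bound -/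

section Coloring

variable {V : Type*} {G : SimpleGraph V}

/-- `n` colours suffice for the subgraph induced by `S`. -/
def ColorableOn (G : SimpleGraph V) (S : Finset V) (n : ℕ) : Prop :=
  ∃ c : V → Fin n, ∀ x ∈ S, ∀ y ∈ S, G.Adj x y → c x ≠ c y

theorem colorableOn_four_of_triangleFree (hP : G.IsIndFree P2P4) (S : Finset V)
    (htri : ∀ a ∈ S, ∀ b ∈ S, ∀ c ∈ S, G.Adj a b → G.Adj b c → ¬ G.Adj a c) :
    G.ColorableOn S 4 := by
  classical
  by_cases hE : ∃ u ∈ S, ∃ v ∈ S, G.Adj u v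
  · obtain ⟨u, hu, v, hv, huv⟩ := hE
    let A : Set V := {x | x ∈ S ∧ ¬ G.Adj u x ∧ ¬ G.Adj v x}
    have hA : (G.induce A).Colorable 2 := by
      refine colorable_two_of_forall (fun a b c ↦ htri a a.2.1 b b.2.1 c c.2.1) ?_
      intro a b c d hab hbc hcd
      refine hP.adj_of_P2P4 (u := u) (v := v) huv hab hbc hcd
        (htri a a.2.1 b b.2.1 c c.2.1 hab hbc) (htri b b.2.1 c c.2.1 d d.2.1 hbc hcd) ?_ ?_
      · simp [a.2.2.1, b.2.2.1, c.2.2.1, d.2.2.1]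
      · simp [a.2.2.2, b.2.2.2, c.2.2.2, d.2.2.2]
    obtain ⟨c⟩ := hA
    -- Colours 0 and 1 go to the neighbours of u and v, colours 2 and 3 to `A`; the final default is
    -- never reached on `S`.
    refine ⟨fun x ↦ if G.Adj u x then 0 else if G.Adj v x then 1 else
      if hx : x ∈ A then (c ⟨x, hx⟩).natAdd 2 else 0, fun x hx y hy hxy ↦ ?_⟩
    have hu' := fun h h' ↦ htri u hu x hx y hy h hxy h'
    have hv' := fun h h' ↦ htri v hv x hx y hy h hxy h'
    have mem : ∀ z ∈ S, ¬ G.Adj u z → ¬ G.Adj v z → z ∈ A := fun z h₁ h₂ h₃ ↦ ⟨h₁, h₂, h₃⟩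
    have hlt : ∀ i : Fin 2, (i.natAdd 2 : Fin 4) ≠ 0 ∧ (i.natAdd 2 : Fin 4) ≠ 1 := by decide
    by_cases h₁ : G.Adj u x <;> by_cases h₂ : G.Adj u y
    · exact absurd h₂ (hu' h₁)
    · by_cases h₃ : G.Adj v y
      · simp [h₁, h₂, h₃]
      · simpa [h₁, h₂, h₃, mem y hy h₂ h₃] using (hlt _).1.symm
    · by_cases h₃ : G.Adj v x
      · simp [h₁, h₂, h₃]
      · simpa [h₁, h₂, h₃, mem x hx h₁ h₃] using (hlt _).1
    · by_cases h₃ : G.Adj v x <;> by_cases h₄ : G.Adj v y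
      · exact absurd h₄ (hv' h₃)
      · simpa [h₁, h₂, h₃, h₄, mem y hy h₂ h₄] using (hlt _).2.symm
      · simpa [h₁, h₂, h₃, h₄, mem x hx h₁ h₃] using (hlt _).2
      · have hne : c ⟨x, mem x hx h₁ h₃⟩ ≠ c ⟨y, mem y hy h₂ h₄⟩ := c.valid hxy
        simp only [h₁, h₂, h₃, h₄, mem x hx h₁ h₃, mem y hy h₂ h₄, if_false, dif_pos]
        exact (Fin.natAdd_injective 2 2).ne hne
  · push Not at hE
    exact ⟨fun _ ↦ 0, fun x hx y hy hxy ↦ absurd hxy (hE x hx y hy)⟩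

/-- In a (bull, diamond)-free graph in which all degrees in `S` are at least `n`, the vertices of a
maximum clique of `S` with `3 ≤ K.card ≤ n` have exactly one neighbour in `S` outside the clique, the
clique has `n` vertices, and the outer neighbours form a clique. -/
theorem exists_outer_neighbor [DecidableEq V] [DecidableRel G.Adj] (hB : G.IsIndFree bull)
    (hD : G.IsIndFree diamond) {S K : Finset V} {n : ℕ} (hKS : K ⊆ S) (hK : G.IsClique K)
    (hmax : ∀ L ⊆ S, G.IsClique L → L.card ≤ K.card) (h3 : 3 ≤ K.card) (hKn : K.card ≤ n)
    (hdeg : ∀ v ∈ S, n ≤ ({x ∈ S | G.Adj v x} : Finset V).card) :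
    K.card = n ∧ ∃ a : V → V, (∀ k ∈ K, a k ∈ S ∧ a k ∉ K ∧ G.Adj k (a k) ∧
      ∀ x ∈ S, x ∉ K → G.Adj k x → x = a k) ∧
      ∀ k ∈ K, ∀ l ∈ K, k ≠ l → G.Adj (a k) (a l) := by
  have third : ∀ k l, ∃ m ∈ K, m ≠ k ∧ m ≠ l := by
    intro k l
    obtain ⟨m, hm⟩ : (K \ {k, l}).Nonempty := by
      rw [← Finset.card_pos]
      have := Finset.le_card_sdiff {k, l} K
      have := Finset.card_le_two (a := k) (b := l)
      omega
    simp only [Finset.mem_sdiff, Finset.mem_insert, Finset.mem_singleton, not_or] at hm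
    exact ⟨m, hm⟩
  -- With two neighbours in `K`, x would by diamond-freeness see all of `K`, contradicting
  -- maximality.
  have uniq : ∀ x ∈ S, x ∉ K → ∀ k ∈ K, ∀ l ∈ K, k ≠ l → G.Adj k x → ¬ G.Adj l x := by
    intro x hx hxK k hk l hl hkl hkx hlx
    have hcl : G.IsClique (insert x K : Finset V) := by
      rw [Finset.coe_insert, isClique_insert]
      refine ⟨hK, fun m hm _ ↦ ?_⟩
      by_cases hmk : m = k
      · exact hmk ▸ hkx.symm
      by_cases hml : m = l
      · exact hml ▸ hlx.symm
      refine (hD.adj_of_diamond (hK hm hk hmk) (hK hm hl hml) (hK hk hl hkl) hkx hlx ?_).symm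
      rintro rfl
      exact hxK hm
    have := hmax _ (Finset.insert_subset hx hKS) hcl
    rw [Finset.card_insert_of_notMem hxK] at this
    omega
  -- A third clique vertex m completes a bull on k, l, m with pendants x, y unless x and y are
  -- adjacent.
  have cross : ∀ x ∈ S, x ∉ K → ∀ y ∈ S, y ∉ K → ∀ k ∈ K, ∀ l ∈ K, k ≠ l → G.Adj k x →
      G.Adj l y → G.Adj x y := by
    intro x hx hxK y hy hyK k hk l hl hkl hkx hly
    obtain ⟨m, hm, hmk, hml⟩ := third k l
    exact hB.adj_of_bull (hK hk hl hkl) (hK hk hm hmk.symm) (hK hl hm hml.symm) hkx hly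
      (uniq y hy hyK l hl k hk hkl.symm hly) (uniq x hx hxK k hk l hl hkl hkx)
      (uniq x hx hxK k hk m hm hmk.symm hkx) (uniq y hy hyK l hl m hm hml.symm hly)
  have ex : ∀ k, ∃ x, k ∈ K → x ∈ S ∧ x ∉ K ∧ G.Adj k x := by
    intro k
    by_contra! h
    have hk := (h k).1
    have hsub : {x ∈ S | G.Adj k x} ⊆ K.erase k := by
      intro x hx
      rw [Finset.mem_filter] at hx
      by_contra hxK
      refine (h x).2 hx.1 (fun hx' ↦ hxK (Finset.mem_erase.2 ⟨hx.2.ne', hx'⟩)) hx.2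
    have := Finset.card_le_card hsub
    have := hdeg k (hKS hk)
    rw [Finset.card_erase_of_mem hk] at *
    omega
  choose a ha using ex
  -- A second outer neighbour x of k would, like `a k`, see the adjacent vertices `a l` and `a m`.
  -- One diamond forces x ~ `a k`, the next forces k ~ `a l`, against `uniq`.
  have haU : ∀ k ∈ K, ∀ x ∈ S, x ∉ K → G.Adj k x → x = a k := by
    intro k hk x hx hxK hkx
    by_contra hne
    obtain ⟨hS, hnK, hadj⟩ := ha k hk
    obtain ⟨l, hl, hlk, -⟩ := third k k
    obtain ⟨m, hm, hmk, hml⟩ := third k l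
    obtain ⟨hlS, hlnK, hladj⟩ := ha l hl
    obtain ⟨hmS, hmnK, hmadj⟩ := ha m hm
    have hxl := cross x hx hxK _ hlS hlnK k hk l hl hlk.symm hkx hladj
    have hxm := cross x hx hxK _ hmS hmnK k hk m hm hmk.symm hkx hmadj
    have hal := cross _ hS hnK _ hlS hlnK k hk l hl hlk.symm hadj hladj
    have ham := cross _ hS hnK _ hmS hmnK k hk m hm hmk.symm hadj hmadj
    have hlm := cross _ hlS hlnK _ hmS hmnK l hl m hm hml.symm hladj hmadj
    have hxa := hD.adj_of_diamond hxl hxm hlm hal.symm ham.symm hne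
    refine uniq _ hlS hlnK l hl k hk hlk hladj
      (hD.adj_of_diamond hkx hadj hxa hxl hal ?_)
    rintro rfl
    exact hlnK hk
  refine ⟨?_, a, fun k hk ↦ ⟨(ha k hk).1, (ha k hk).2.1, (ha k hk).2.2, haU k hk⟩,
    fun k hk l hl hkl ↦ cross _ (ha k hk).1 (ha k hk).2.1 _ (ha l hl).1 (ha l hl).2.1 k hk l hl hkl
      (ha k hk).2.2 (ha l hl).2.2⟩
  obtain ⟨k, hk⟩ : K.Nonempty := Finset.card_pos.1 (by omega)
  have hsub : {x ∈ S | G.Adj k x} ⊆ insert (a k) (K.erase k) := by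
    intro x hx
    rw [Finset.mem_filter] at hx
    by_cases hxK : x ∈ K
    · exact Finset.mem_insert_of_mem (Finset.mem_erase.2 ⟨hx.2.ne', hxK⟩)
    · rw [haU k hk x hx.1 hxK hx.2]
      exact Finset.mem_insert_self _ _
  have h₁ := (hdeg k (hKS hk)).trans (Finset.card_le_card hsub)
  have h₂ := Finset.card_insert_le (a k) (K.erase k)
  rw [Finset.card_erase_of_mem hk] at h₂
  omega

theorem IsP2P4BullDiamondFree.colorableOn (h : G.IsP2P4BullDiamondFree) {n : ℕ} (hn : 4 ≤ n)
    (hω : ∀ K : Finset V, G.IsClique K → K.card ≤ n) (S : Finset V) : G.ColorableOn S n := by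
  classical
  obtain ⟨hP, hB, hD⟩ := h
  induction S using Finset.strongInduction with
  | H S ih =>
  by_cases hdeg : ∀ v ∈ S, n ≤ ({x ∈ S | G.Adj v x} : Finset V).card
  swap
  · push Not at hdeg
    obtain ⟨v, hv, hlt⟩ := hdeg
    obtain ⟨c, hc⟩ := ih _ (Finset.erase_ssubset hv)
    obtain ⟨i, hi⟩ : ∃ i, i ∉ ({x ∈ S | G.Adj v x} : Finset V).image c := by
      by_contra! hall
      have h₁ := Finset.card_le_card (fun i _ ↦ hall i : Finset.univ ⊆ _)
      rw [Finset.card_univ, Fintype.card_fin] at h₁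
      exact absurd (h₁.trans Finset.card_image_le) (by omega)
    have hi' : ∀ x ∈ S, G.Adj v x → c x ≠ i := fun x hx hvx hxi ↦
      hi (Finset.mem_image.2 ⟨x, Finset.mem_filter.2 ⟨hx, hvx⟩, hxi⟩)
    refine ⟨Function.update c v i, fun x hx y hy hxy ↦ ?_⟩
    by_cases hxv : x = v
    · subst hxv
      rw [Function.update_self, Function.update_of_ne hxy.ne']
      exact (hi' y hy hxy).symm
    · by_cases hyv : y = v
      · subst hyv
        rw [Function.update_self, Function.update_of_ne hxy.ne]
        exact hi' x hx hxy.symm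
      · rw [Function.update_of_ne hxv, Function.update_of_ne hyv]
        exact hc x (Finset.mem_erase.2 ⟨hxv, hx⟩) y (Finset.mem_erase.2 ⟨hyv, hy⟩) hxy
  by_cases htri : ∀ a ∈ S, ∀ b ∈ S, ∀ c ∈ S, G.Adj a b → G.Adj b c → ¬ G.Adj a c
  · obtain ⟨c, hc⟩ := colorableOn_four_of_triangleFree hP S htri
    exact ⟨fun x ↦ (c x).castLE hn, fun x hx y hy hxy hne ↦
      hc x hx y hy hxy (Fin.castLE_injective hn hne)⟩
  push Not at htri
  obtain ⟨u, hu, v, hv, w, hw, huv, hvw, huw⟩ := htri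
  obtain ⟨K, hKmem, hKmax⟩ := ({L ∈ S.powerset | G.IsClique L} : Finset (Finset V)).exists_max_image
    Finset.card ⟨∅, by simp⟩
  simp only [Finset.mem_filter, Finset.mem_powerset] at hKmem hKmax
  obtain ⟨hKS, hK⟩ := hKmem
  replace hKmax : ∀ L ⊆ S, G.IsClique L → L.card ≤ K.card := fun L h₁ h₂ ↦ hKmax L ⟨h₁, h₂⟩
  have h3 : 3 ≤ K.card := by
    have ht : G.IsNClique 3 {u, v, w} := is3Clique_triple_iff.2 ⟨huv, huw, hvw⟩
    rw [← ht.card_eq]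
    refine hKmax _ ?_ ht.isClique
    simp [Finset.insert_subset_iff, hu, hv, hw]
  obtain ⟨hcard, a, ha, haa⟩ := exists_outer_neighbor hB hD hKS hK hKmax h3 (hω K hK) hdeg
  have hinj : Set.InjOn a K := fun k hk l hl hkl ↦ by
    by_contra hne
    exact (haa k hk l hl hne).ne hkl
  set L := K.image a with hL
  have hLcard : L.card = K.card := Finset.card_image_of_injOn hinj
  have hLS : L ⊆ S := Finset.image_subset_iff.2 fun k hk ↦ (ha k hk).1
  have hLcl : G.IsClique L := by
    intro x hx y hy hxy
    obtain ⟨k, hk, rfl⟩ := Finset.mem_image.1 hx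
    obtain ⟨l, hl, rfl⟩ := Finset.mem_image.1 hy
    exact haa k hk l hl (by rintro rfl; exact hxy rfl)
  have hdisj : ∀ x ∈ K, x ∉ L := by
    intro x hx hxL
    obtain ⟨k, hk, rfl⟩ := Finset.mem_image.1 hxL
    exact (ha k hk).2.1 hx
  -- `L` is also a maximum clique of `S`, and its outer neighbour map `b` inverts `a`.
  obtain ⟨-, b, hb, -⟩ := exists_outer_neighbor hB hD hLS hLcl (hLcard ▸ hKmax) (hLcard ▸ h3)
    (hω L hLcl) hdeg
  have hba : ∀ k ∈ K, b (a k) = k := fun k hk ↦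
    ((hb _ (Finset.mem_image_of_mem a hk)).2.2.2 k (hKS hk) (hdisj k hk)
      (ha k hk).2.2.1.symm).symm
  have hab : ∀ x ∈ L, b x ∈ K ∧ a (b x) = x := by
    intro x hx
    obtain ⟨k, hk, rfl⟩ := Finset.mem_image.1 hx
    rw [hba k hk]
    exact ⟨hk, rfl⟩
  obtain ⟨c, hc⟩ := ih (S \ (K ∪ L)) (by
    obtain ⟨k, hk⟩ : K.Nonempty := Finset.card_pos.1 (by omega)
    exact Finset.sdiff_ssubset (Finset.union_subset hKS hLS)
      ⟨k, Finset.mem_union_left _ hk⟩)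
  let e : K ≃ Fin n := K.equivFinOfCardEq hcard
  have : NeZero n := ⟨by omega⟩
  have hone : (1 : Fin n) ≠ 0 := by
    intro h10
    have := congrArg Fin.val h10
    rw [Fin.val_one', Fin.val_zero, Nat.mod_eq_of_lt (by omega)] at this
    omega
  -- The shift by one separates the ends of each matching edge, since n > 1.
  let f : V → Fin n := fun x ↦ if hx : x ∈ K then e ⟨x, hx⟩ else
    if hx : x ∈ L then e ⟨b x, (hab x hx).1⟩ + 1 else c x
  have fK : ∀ x (hx : x ∈ K), f x = e ⟨x, hx⟩ := fun x hx ↦ dif_pos hx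
  have fL : ∀ x (hx : x ∈ L), f x = e ⟨b x, (hab x hx).1⟩ + 1 := fun x hx ↦ by
    simp only [f, dif_neg (fun h ↦ hdisj x h hx), dif_pos hx]
  have fc : ∀ x, x ∉ K → x ∉ L → f x = c x := fun x h₁ h₂ ↦ by simp only [f, dif_neg h₁, dif_neg h₂]
  -- Up to swapping x and y, these three cases cover every edge.
  have wlog_aux : ∀ x ∈ S, ∀ y ∈ S, G.Adj x y → x ∈ K ∨ (y ∉ K ∧ x ∈ L) ∨
      (x ∉ K ∧ x ∉ L ∧ y ∉ K ∧ y ∉ L) → f x ≠ f y := by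
    intro x hx y hy hxy hcases hf
    rcases hcases with hxK | ⟨hyK, hxL⟩ | ⟨h₁, h₂, h₃, h₄⟩
    · by_cases hyK : y ∈ K
      · rw [fK x hxK, fK y hyK] at hf
        exact hxy.ne (congrArg Subtype.val (e.injective hf))
      · have hya := (ha x hxK).2.2.2 y hy hyK hxy
        have hyL : y ∈ L := hya ▸ Finset.mem_image_of_mem a hxK
        have hbx : b y = x := by rw [hya, hba x hxK]
        rw [fK x hxK, fL y hyL] at hf
        simp only [hbx] at hf
        exact hone (by simpa using hf)
    · by_cases hyL : y ∈ L
      · rw [fL x hxL, fL y hyL, add_left_inj] at hf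
        have hbb : b x = b y := congrArg Subtype.val (e.injective hf)
        exact hxy.ne (by rw [← (hab x hxL).2, ← (hab y hyL).2, hbb])
      · exact hyK ((hb x hxL).2.2.2 y hy hyL hxy ▸ (hab x hxL).1)
    · rw [fc x h₁ h₂, fc y h₃ h₄] at hf
      exact hc x (by simp [hx, h₁, h₂]) y (by simp [hy, h₃, h₄]) hxy hf
  refine ⟨f, fun x hx y hy hxy ↦ ?_⟩
  have h₁ := wlog_aux x hx y hy hxy
  have h₂ := fun h ↦ (wlog_aux y hy x hx hxy.symm h).symm
  tauto

end Coloring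

theorem IsP2P4BullDiamondFree.chromaticNumber_le {V : Type*} [Finite V] {G : SimpleGraph V}
    (h : G.IsP2P4BullDiamondFree) : G.chromaticNumber ≤ ((max 4 G.cliqueNum : ℕ) : ℕ∞) := by
  have := Fintype.ofFinite V
  rw [chromaticNumber_le_iff_colorable]
  obtain ⟨c, hc⟩ := h.colorableOn (le_max_left 4 G.cliqueNum)
    (fun K hK ↦ (IsClique.card_le_cliqueNum (tc := hK)).trans (le_max_right _ _)) Finset.univ
  exact ⟨Coloring.mk c fun {x y} hxy ↦ hc x (Finset.mem_univ _) y (Finset.mem_univ _) hxy⟩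

/-! ### Optimality: complete graphs and the Grötzsch graph -/

theorem isP2P4BullDiamondFree_top (V : Type*) : (⊤ : SimpleGraph V).IsP2P4BullDiamondFree := by
  have aux : ∀ {W : Type} {H : SimpleGraph W} (i j : W), i ≠ j → ¬ H.Adj i j →
      (⊤ : SimpleGraph V).IsIndFree H := fun i j hij hadj ⟨f⟩ ↦
    hadj (f.map_adj_iff.1 (f.injective.ne hij))
  exact ⟨aux (.inl 0) (.inr 0) (by simp) (by simp [P2P4]), aux 3 4 (by decide) (by simp [bull]),
    aux 0 3 (by decide) (by simp [diamond])⟩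

/-- The Grötzsch graph: the Mycielskian of the 5-cycle `0, 1, 2, 3, 4`, with `5 + i` the copy of `i`
and `10` the apex. -/
def grotzsch : SimpleGraph (Fin 11) :=
  fromRel fun i j ↦ (i.val, j.val) ∈ [(0, 1), (1, 2), (2, 3), (3, 4), (4, 0), (5, 1), (5, 4),
    (6, 0), (6, 2), (7, 1), (7, 3), (8, 2), (8, 4), (9, 3), (9, 0), (10, 5), (10, 6), (10, 7),
    (10, 8), (10, 9)]

instance : DecidableRel grotzsch.Adj := fun i j ↦
  decidable_of_iff _ (fromRel_adj _ i j).symm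

theorem grotzsch_triangleFree :
    ∀ a b, grotzsch.Adj a b → ∀ c, grotzsch.Adj b c → ¬ grotzsch.Adj a c := by
  decide +kernel

set_option synthInstance.maxSize 1000 in
set_option synthInstance.maxHeartbeats 200000 in
-- Each condition stands directly after the vertices it concerns, so the exhaustive check prunes
-- early.
theorem grotzsch_no_P2P4 : ∀ u v, grotzsch.Adj u v → ∀ a, ¬ grotzsch.Adj u a → ¬ grotzsch.Adj v a →
    ∀ b, grotzsch.Adj a b → ¬ grotzsch.Adj u b → ¬ grotzsch.Adj v b →
    ∀ c, grotzsch.Adj b c → ¬ grotzsch.Adj u c → ¬ grotzsch.Adj v c → ¬ grotzsch.Adj a c →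
    ∀ d, grotzsch.Adj c d → ¬ grotzsch.Adj u d → ¬ grotzsch.Adj v d → ¬ grotzsch.Adj b d →
      grotzsch.Adj a d := by
  decide +kernel

theorem isP2P4BullDiamondFree_grotzsch : grotzsch.IsP2P4BullDiamondFree := by
  refine ⟨isIndFree_of_forall fun f hf ↦ ?_, isIndFree_of_forall fun f hf ↦ ?_,
    isIndFree_of_forall fun f hf ↦ ?_⟩
  · have := grotzsch_no_P2P4 (f (.inl 0)) (f (.inl 1)) ((hf _ _).2 ?_)
      (f (.inr 0)) (mt (hf _ _).1 ?_) (mt (hf _ _).1 ?_)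
      (f (.inr 1)) ((hf _ _).2 ?_) (mt (hf _ _).1 ?_) (mt (hf _ _).1 ?_)
      (f (.inr 2)) ((hf _ _).2 ?_) (mt (hf _ _).1 ?_) (mt (hf _ _).1 ?_) (mt (hf _ _).1 ?_)
      (f (.inr 3)) ((hf _ _).2 ?_) (mt (hf _ _).1 ?_) (mt (hf _ _).1 ?_) (mt (hf _ _).1 ?_)
    · rw [hf] at this
      simp [P2P4, pathGraph_adj] at this
    all_goals simp [P2P4, pathGraph_adj]
  · exact grotzsch_triangleFree (f 0) (f 1) ((hf _ _).2 (by simp [bull])) (f 2)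
      ((hf _ _).2 (by simp [bull])) ((hf _ _).2 (by simp [bull]))
  · exact grotzsch_triangleFree (f 0) (f 1) ((hf _ _).2 (by simp [diamond])) (f 2)
      ((hf _ _).2 (by simp [diamond])) ((hf _ _).2 (by simp [diamond]))

theorem cliqueNum_grotzsch : grotzsch.cliqueNum = 2 := by
  apply le_antisymm
  · by_contra! h
    obtain ⟨s, hs⟩ := grotzsch.exists_isNClique_cliqueNum
    obtain ⟨t, hts, ht⟩ := Finset.exists_subset_card_eq (hs.card_eq ▸ h : 3 ≤ s.card)
    obtain ⟨a, b, c, hab, hac, hbc, -⟩ := is3Clique_iff.1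
      (⟨hs.isClique.subset (by exact_mod_cast hts), ht⟩ : grotzsch.IsNClique 3 t)
    exact grotzsch_triangleFree a b hab c hbc hac
  · have h : grotzsch.IsClique ({0, 1} : Finset (Fin 11)) := by
      simpa [isClique_pair] using (by decide : grotzsch.Adj 0 1)
    simpa using IsClique.card_le_cliqueNum (tc := h)

theorem not_colorable_three_grotzsch : ¬ grotzsch.Colorable 3 := by
  rintro ⟨c⟩
  -- Here w colours the apex, uᵢ the 5-cycle and vᵢ the copy of vertex i.
  have key : ∀ w u₀ u₁ : Fin 3, u₀ ≠ u₁ → ∀ u₂, u₁ ≠ u₂ → ∀ u₃, u₂ ≠ u₃ → ∀ u₄, u₃ ≠ u₄ → u₄ ≠ u₀ →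
      ∀ v₀, w ≠ v₀ → v₀ ≠ u₁ → v₀ ≠ u₄ → ∀ v₁, w ≠ v₁ → v₁ ≠ u₀ → v₁ ≠ u₂ →
      ∀ v₂, w ≠ v₂ → v₂ ≠ u₁ → v₂ ≠ u₃ → ∀ v₃, w ≠ v₃ → v₃ ≠ u₂ → v₃ ≠ u₄ →
      ∀ v₄, w ≠ v₄ → v₄ ≠ u₃ → v₄ ≠ u₀ → False := by
    decide +kernel
  refine key (c 10) (c 0) (c 1) ?_ (c 2) ?_ (c 3) ?_ (c 4) ?_ ?_ (c 5) ?_ ?_ ?_ (c 6) ?_ ?_ ?_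
    (c 7) ?_ ?_ ?_ (c 8) ?_ ?_ ?_ (c 9) ?_ ?_ ?_
  all_goals exact c.valid (by decide)

theorem chromaticNumber_grotzsch : grotzsch.chromaticNumber = 4 := by
  apply le_antisymm
  · simpa [cliqueNum_grotzsch] using isP2P4BullDiamondFree_grotzsch.chromaticNumber_le
  · by_contra! h
    have h' : grotzsch.chromaticNumber ≤ (3 : ℕ) := Order.le_of_lt_add_one h
    exact not_colorable_three_grotzsch (chromaticNumber_le_iff_colorable.1 h')

theorem cliqueNum_top_fin (k : ℕ) : (⊤ : SimpleGraph (Fin k)).cliqueNum = k := by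
  apply le_antisymm
  · obtain ⟨s, hs⟩ := (⊤ : SimpleGraph (Fin k)).exists_isNClique_cliqueNum
    simpa [hs.card_eq] using s.card_le_univ
  · have h : (⊤ : SimpleGraph (Fin k)).IsClique (Finset.univ : Finset (Fin k)) :=
      fun _ _ _ _ hne ↦ hne
    simpa using IsClique.card_le_cliqueNum (tc := h)

end SimpleGraph

theorem mainTheorem5 :
    (∀ (V : Type*) [Finite V] (G : SimpleGraph V), G.IsP2P4BullDiamondFree →
      G.chromaticNumber ≤ ((max 4 G.cliqueNum : ℕ) : ℕ∞)) ∧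
    (∀ k : ℕ, (k = 2 ∨ 4 ≤ k) →
      ∃ (n : ℕ) (G : SimpleGraph (Fin n)), G.IsP2P4BullDiamondFree ∧
        G.cliqueNum = k ∧ G.chromaticNumber = ((max 4 k : ℕ) : ℕ∞)) := by
  refine ⟨fun V _ G hG ↦ hG.chromaticNumber_le, fun k hk ↦ ?_⟩
  rcases hk with rfl | hk
  · exact ⟨11, SimpleGraph.grotzsch, SimpleGraph.isP2P4BullDiamondFree_grotzsch,
      SimpleGraph.cliqueNum_grotzsch, SimpleGraph.chromaticNumber_grotzsch⟩
  · refine ⟨k, ⊤, SimpleGraph.isP2P4BullDiamondFree_top _, SimpleGraph.cliqueNum_top_fin k, ?_⟩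
    rw [SimpleGraph.chromaticNumber_top, Fintype.card_fin, max_eq_right hk]
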